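/- For $n\ge 1$ let $N=2^n$, let $\mathcal H_n=(\mathbb C^2)^{\otimes n}$ with computational basis $|0\rangle,\dots,|N-1\rangle$, and let $\sigma^y=\begin{pmatrix}0&-i\\ i&0\end{pmatrix}$. The spin-flip is $\mho|\psi\rangle=(-i\sigma^y)^{\otimes n}\,\overline{|\psi\rangle}$, and the concurrence bilinear form is $\mathcal C_n(|\phi\rangle,|\psi\rangle)=\overline{\langle\phi|\mho|\psi\rangle}$. For $v\in SU(N)$ the pairwise concurrence capacity is $$\kappa_n(v)=\max\{\,|\mathcal C_n(v|\phi\rangle,v|\psi\rangle)| \;:\; \langle\phi|\phi\rangle=\langle\psi|\psi\rangle=1,\ \mathcal C_n(|\phi\rangle,|\psi\rangle)=0\,\}.$$ For odd $n$ let $$\mathfrak a=\operatorname{span}_{\mathbb R}\{\, i|j\rangle\langle j|+i|N-j-1\rangle\langle N-j-1|-i|j+1\rangle\langle j+1|-i|N-j-2\rangle\langle N-j-2| \;:\; 0\le j\le 2^{n-1}-2\,\},$$ and let $A=\exp\mathfrak a\subset SU(N)$ be the resulting compact abelian group (the group of diagonal factors $a$ in the concurrence canonical decomposition $v=k_1ak_2$),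 with Haar measure $da$ normalized to total mass $1$. Then, for $n=2p-1$ with $p\ge 1$, the set $\{a\in A : \kappa_n(a)=1\}$ is measurable, and $$\lim_{p\to\infty} da\big(\{a\in A : \kappa_n(a)=1\}\big)=1 .$$ -/

import Mathlib

open Filter Topology MeasureTheory

namespace Concurrence

noncomputable section

/-- The `n`-qubit state space `(ℂ²)^{⊗ n}` in its computational basis `|0⟩, …, |N-1⟩`, `N = 2 ^ n`. -/
abbrev StateSpace (n : ℕ) : Type := EuclideanSpace ℂ (Fin (2 ^ n))

/-- The group `SU(N)`, `N = 2 ^ n`. -/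
abbrev SU (n : ℕ) : Type := Matrix.specialUnitaryGroup (Fin (2 ^ n)) ℂ

/-- The action of a matrix on states. -/
def act {n : ℕ} (v : Matrix (Fin (2 ^ n)) (Fin (2 ^ n)) ℂ) (ψ : StateSpace n) : StateSpace n :=
  WithLp.toLp 2 (v.mulVec ψ.ofLp)

/-- The Pauli matrix `σ^y`. -/
def sigmaY : Matrix (Fin 2) (Fin 2) ℂ := !![0, -Complex.I; Complex.I, 0]

/-- The `l`-th binary digit of the basis index `j`. -/
def bit {n : ℕ} (j : Fin (2 ^ n)) (l : Fin n) : Fin 2 := finFunctionFinEquiv.symm j l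

/-- The `n`-fold Kronecker power `(-i σ^y)^{⊗ n}`: its `(j, k)` entry is the product over the
qubits of the entries of `-i σ^y` at the binary digits of `j` and `k`. (All tensor factors are
equal, so the order in which the qubits are numbered is immaterial.) -/
def flipMatrix (n : ℕ) : Matrix (Fin (2 ^ n)) (Fin (2 ^ n)) ℂ :=
  Matrix.of fun j k => ∏ l : Fin n, ((-Complex.I) • sigmaY) (bit j l) (bit k l)

/-- The spin-flip `℧ |ψ⟩ = (-i σ^y)^{⊗ n} \overline{|ψ⟩}`. -/
def spinFlip {n : ℕ} (ψ : StateSpace n) : StateSpace n :=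
  act (flipMatrix n) (WithLp.toLp 2 fun k => starRingEnd ℂ (ψ k))

/-- The concurrence bilinear form `𝒞_n(|φ⟩, |ψ⟩)`, the complex conjugate of `⟨φ|℧|ψ⟩`. -/
def form {n : ℕ} (φ ψ : StateSpace n) : ℂ :=
  starRingEnd ℂ (inner ℂ φ (spinFlip ψ))

/-- The values `|𝒞_n(v|φ⟩, v|ψ⟩)|` over all pairs of normalized states with
`𝒞_n(|φ⟩, |ψ⟩) = 0`. -/
def capacityValues {n : ℕ} (v : SU n) : Set ℝ :=
  {r | ∃ φ ψ : StateSpace n, ‖φ‖ = 1 ∧ ‖ψ‖ = 1 ∧ form φ ψ = 0 ∧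
    r = ‖form (act v.1 φ) (act v.1 ψ)‖}

/-- The pairwise concurrence capacity `κ_n(v)`. The supremum is a maximum for `n ≥ 1`, see
`isGreatest_kappa`. -/
def kappa {n : ℕ} (v : SU n) : ℝ := sSup (capacityValues v)

/-- The abelian algebra `𝔞` of the concurrence canonical decomposition in an odd number `n` of
qubits: the real span of the matrices
`i|j⟩⟨j| + i|N-j-1⟩⟨N-j-1| - i|j+1⟩⟨j+1| - i|N-j-2⟩⟨N-j-2|`, `0 ≤ j ≤ 2^(n-1) - 2`.
Here `k` is `j + 1`, and `Fin.rev j` is `N - j - 1`. -/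
def oddAlgebra (n : ℕ) : Submodule ℝ (Matrix (Fin (2 ^ n)) (Fin (2 ^ n)) ℂ) :=
  Submodule.span ℝ {X | ∃ j k : Fin (2 ^ n), (k : ℕ) = j + 1 ∧ (j : ℕ) + 2 ≤ 2 ^ (n - 1) ∧
    X = Complex.I • (Matrix.single j j 1 + Matrix.single j.rev j.rev 1
      - Matrix.single k k 1 - Matrix.single k.rev k.rev 1)}

/-! Facts needed for the group `A = exp 𝔞`. -/

/-- Integer phase vector of a generator. -/
def genPhase {n : ℕ} (j k : Fin (2 ^ n)) : Fin (2 ^ n) → ℤ :=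
  Pi.single j 1 + Pi.single j.rev 1 - Pi.single k 1 - Pi.single k.rev 1

/-- Index type of the generators. -/
abbrev GenIdx (n : ℕ) : Type :=
  {q : Fin (2 ^ n) × Fin (2 ^ n) // (q.2 : ℕ) = q.1 + 1 ∧ (q.1 : ℕ) + 2 ≤ 2 ^ (n - 1)}

/-- The phases of a real combination of the generators. -/
def phase {n : ℕ} (t : GenIdx n → ℝ) (l : Fin (2 ^ n)) : ℝ :=
  ∑ q : GenIdx n, t q * (genPhase q.1.1 q.1.2 l : ℝ)

theorem sum_genPhase {n : ℕ} (j k : Fin (2 ^ n)) : ∑ l, genPhase j k l = 0 := by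
  simp [genPhase, Finset.sum_sub_distrib, Finset.sum_add_distrib]

theorem sum_phase {n : ℕ} (t : GenIdx n → ℝ) : ∑ l, phase t l = 0 := by
  unfold phase
  rw [Finset.sum_comm]
  refine Finset.sum_eq_zero fun q _ => ?_
  rw [← Finset.mul_sum, ← Int.cast_sum, sum_genPhase]
  simp

theorem mem_oddAlgebra_iff {n : ℕ} (X : Matrix (Fin (2 ^ n)) (Fin (2 ^ n)) ℂ) :
    X ∈ oddAlgebra n ↔
      ∃ t : GenIdx n → ℝ, X = Matrix.diagonal fun l => (phase t l : ℂ) * Complex.I := by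
  have hgen : ∀ j k : Fin (2 ^ n),
      Complex.I • (Matrix.single j j 1 + Matrix.single j.rev j.rev 1
      - Matrix.single k k 1 - Matrix.single k.rev k.rev (1 : ℂ)) =
      Matrix.diagonal fun l => ((genPhase j k l : ℤ) : ℂ) * Complex.I := by
    intro j k
    simp only [← Matrix.diagonal_single, Matrix.diagonal_add, Matrix.diagonal_sub]
    rw [← Matrix.diagonal_smul]
    congr 1
    funext l
    simp [genPhase, Pi.single_apply]
    ring
  have hset : {X : Matrix (Fin (2 ^ n)) (Fin (2 ^ n)) ℂ | ∃ j k : Fin (2 ^ n),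
      (k : ℕ) = j + 1 ∧ (j : ℕ) + 2 ≤ 2 ^ (n - 1) ∧
      X = Complex.I • (Matrix.single j j 1 + Matrix.single j.rev j.rev 1
      - Matrix.single k k 1 - Matrix.single k.rev k.rev 1)} =
      Set.range fun q : GenIdx n =>
        (Matrix.diagonal fun l => ((genPhase q.1.1 q.1.2 l : ℤ) : ℂ) * Complex.I) := by
    ext X
    constructor
    · rintro ⟨j, k, h1, h2, rfl⟩
      exact ⟨⟨(j, k), h1, h2⟩, (hgen j k).symm⟩
    · rintro ⟨⟨⟨j, k⟩, h1, h2⟩, rfl⟩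
      exact ⟨j, k, h1, h2, (hgen j k).symm⟩
  rw [oddAlgebra, hset, Submodule.mem_span_range_iff_exists_fun]
  refine exists_congr fun t => ?_
  rw [eq_comm]
  refine Eq.congr_right ?_
  ext a b
  rw [Matrix.sum_apply]
  by_cases hab : a = b
  · subst hab
    simp [phase, Finset.sum_mul, mul_assoc]
  · simp [hab]

/-- `exp` of the element of `𝔞` with coordinates `t`. -/
theorem exp_phase {n : ℕ} (t : GenIdx n → ℝ) :
    NormedSpace.exp (Matrix.diagonal fun l => (phase t l : ℂ) * Complex.I) =
      Matrix.diagonal fun l => Complex.exp ((phase t l : ℂ) * Complex.I) := by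
  rw [Matrix.exp_diagonal]
  congr 1
  funext l
  rw [Pi.coe_exp, Complex.exp_eq_exp_ℂ]

theorem expPhase_mem {n : ℕ} (t : GenIdx n → ℝ) :
    (Matrix.diagonal fun l => Complex.exp ((phase t l : ℂ) * Complex.I)) ∈
      Matrix.specialUnitaryGroup (Fin (2 ^ n)) ℂ := by
  rw [Matrix.mem_specialUnitaryGroup_iff]
  constructor
  · rw [Matrix.mem_unitaryGroup_iff, Matrix.star_eq_conjTranspose, Matrix.diagonal_conjTranspose,
      Matrix.diagonal_mul_diagonal, ← Matrix.diagonal_one]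
    congr 1
    funext l
    simp only [Pi.star_apply, RCLike.star_def]
    rw [Complex.mul_conj, Complex.normSq_eq_norm_sq, Complex.norm_exp_ofReal_mul_I]
    simp
  · rw [Matrix.det_diagonal, ← Complex.exp_sum, ← Finset.sum_mul, ← Complex.ofReal_sum, sum_phase]
    simp

/-- `exp 𝔞` lies in `SU(N)`, so that nothing is lost in viewing `A` inside `SU(N)`. -/
theorem exp_mem_of_mem_oddAlgebra {n : ℕ} {X : Matrix (Fin (2 ^ n)) (Fin (2 ^ n)) ℂ}
    (hX : X ∈ oddAlgebra n) :
    NormedSpace.exp X ∈ Matrix.specialUnitaryGroup (Fin (2 ^ n)) ℂ := by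
  obtain ⟨t, rfl⟩ := (mem_oddAlgebra_iff X).1 hX
  rw [exp_phase]
  exact expPhase_mem t

theorem commute_of_mem_oddAlgebra {n : ℕ} {X Y : Matrix (Fin (2 ^ n)) (Fin (2 ^ n)) ℂ}
    (hX : X ∈ oddAlgebra n) (hY : Y ∈ oddAlgebra n) : Commute X Y := by
  obtain ⟨t, rfl⟩ := (mem_oddAlgebra_iff X).1 hX
  obtain ⟨s, rfl⟩ := (mem_oddAlgebra_iff Y).1 hY
  rw [Commute, SemiconjBy, Matrix.diagonal_mul_diagonal, Matrix.diagonal_mul_diagonal]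
  simp only [mul_comm]

/-- The group `A = exp 𝔞` (odd number `n` of qubits), as a subgroup of `SU(N)`. -/
def oddTorus (n : ℕ) : Subgroup (SU n) where
  carrier := {a | ∃ X ∈ oddAlgebra n, (a : Matrix (Fin (2 ^ n)) (Fin (2 ^ n)) ℂ)
    = NormedSpace.exp X}
  one_mem' := ⟨0, Submodule.zero_mem _, by simp [NormedSpace.exp_zero]⟩
  mul_mem' := by
    rintro a b ⟨X, hX, ha⟩ ⟨Y, hY, hb⟩
    refine ⟨X + Y, Submodule.add_mem _ hX hY, ?_⟩
    rw [Matrix.exp_add_of_commute X Y (commute_of_mem_oddAlgebra hX hY), ← ha, ← hb]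
    rfl
  inv_mem' := by
    rintro a ⟨X, hX, ha⟩
    refine ⟨-X, Submodule.neg_mem _ hX, ?_⟩
    rw [Matrix.exp_neg, ← ha]
    refine (Matrix.inv_eq_left_inv ?_).symm
    exact congrArg Subtype.val (inv_mul_cancel a)

instance instTopGroupSU (n : ℕ) : IsTopologicalGroup (SU n) where
  continuous_inv :=
    Continuous.subtype_mk (f := fun a : SU n => star a.1) (continuous_star.comp continuous_subtype_val) _

theorem phase_continuous {n : ℕ} (l : Fin (2 ^ n)) :
    Continuous fun t : GenIdx n → ℝ => phase t l := by
  unfold phase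
  fun_prop

/-- The parametrization of `A` by the coordinates of `𝔞`. -/
def param {n : ℕ} (t : GenIdx n → ℝ) : oddTorus n :=
  ⟨⟨_, expPhase_mem t⟩, _, (mem_oddAlgebra_iff _).2 ⟨t, rfl⟩, (exp_phase t).symm⟩

theorem param_continuous (n : ℕ) : Continuous (param (n := n)) := by
  refine Continuous.subtype_mk (Continuous.subtype_mk ?_ _) _
  refine Continuous.matrix_diagonal (continuous_pi fun l => ?_)
  have := phase_continuous l
  fun_prop

theorem param_surjOn (n : ℕ) :
    param (n := n) '' (Set.Icc 0 fun _ => 2 * Real.pi) = Set.univ := by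
  refine Set.eq_univ_of_forall ?_
  rintro ⟨⟨a, ha⟩, X, hX, hXa⟩
  obtain ⟨t, rfl⟩ := (mem_oddAlgebra_iff X).1 hX
  rw [exp_phase] at hXa
  have hpi : 0 < 2 * Real.pi := Real.two_pi_pos
  refine ⟨fun q => toIcoMod hpi 0 (t q), ⟨fun q => ?_, fun q => ?_⟩, ?_⟩
  · exact left_le_toIcoMod hpi 0 (t q)
  · have := (toIcoMod_lt_right hpi 0 (t q)).le
    simpa using this
  · refine Subtype.ext (Subtype.ext ?_)
    change Matrix.diagonal _ = a
    refine Eq.trans ?_ hXa.symm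
    congr 1
    funext l
    rw [Complex.exp_eq_exp_iff_exists_int]
    refine ⟨-∑ q : GenIdx n, toIcoDiv hpi 0 (t q) * genPhase q.1.1 q.1.2 l, ?_⟩
    have h : phase (fun q => toIcoMod hpi 0 (t q)) l = phase t l +
        ((-∑ q : GenIdx n, toIcoDiv hpi 0 (t q) * genPhase q.1.1 q.1.2 l : ℤ) : ℝ)
          * (2 * Real.pi) := by
      simp only [phase, toIcoMod, zsmul_eq_mul, sub_mul, Finset.sum_sub_distrib]
      push_cast
      rw [neg_mul, Finset.sum_mul, ← sub_eq_add_neg]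
      congr 1
      refine Finset.sum_congr rfl fun q _ => ?_
      ring
    rw [h]
    push_cast
    ring

instance instCompactOddTorus (n : ℕ) : CompactSpace (oddTorus n) :=
  ⟨by rw [← param_surjOn n]; exact isCompact_Icc.image (param_continuous n)⟩

/-- The Borel σ-algebra on `A`. -/
instance instMeasurableOddTorus (n : ℕ) : MeasurableSpace (oddTorus n) := borel _

instance instBorelOddTorus (n : ℕ) : BorelSpace (oddTorus n) := ⟨rfl⟩

/-- The Haar measure `da` on `A`, normalized to be a probability measure. -/
def da (n : ℕ) : Measure (oddTorus n) :=
  Measure.haarMeasure (⊤ : TopologicalSpace.PositiveCompacts (oddTorus n))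

instance instProbabilityDa (n : ℕ) : IsProbabilityMeasure (da n) :=
  ⟨Measure.haarMeasure_self (K₀ := (⊤ : TopologicalSpace.PositiveCompacts (oddTorus n)))⟩

/-! The supremum in the definition of `kappa` is attained. -/

theorem act_continuous {n : ℕ} (v : Matrix (Fin (2 ^ n)) (Fin (2 ^ n)) ℂ) :
    Continuous (act v) := by
  unfold act
  have : Continuous fun ψ : StateSpace n => v.mulVec ψ.ofLp :=
    Continuous.matrix_mulVec continuous_const (PiLp.continuous_ofLp 2 _)
  exact (PiLp.continuous_toLp 2 _).comp this

theorem form_continuous (n : ℕ) :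
    Continuous fun z : StateSpace n × StateSpace n => form z.1 z.2 := by
  have h : Continuous (spinFlip (n := n)) := by
    refine (act_continuous _).comp ((PiLp.continuous_toLp 2 _).comp ?_)
    fun_prop
  exact Complex.continuous_conj.comp (continuous_fst.inner (h.comp continuous_snd))

theorem isGreatest_kappa {n : ℕ} (hn : 1 ≤ n) (v : SU n) :
    IsGreatest (capacityValues v) (kappa v) := by
  have hcomp : IsCompact (capacityValues v) := by
    let T : Set (StateSpace n × StateSpace n) :=
      (Metric.sphere 0 1 ×ˢ Metric.sphere 0 1) ∩ {z | form z.1 z.2 = 0}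
    have hT : IsCompact T := ((isCompact_sphere _ _).prod (isCompact_sphere _ _)).inter_right
      (isClosed_eq (form_continuous n) continuous_const)
    have hf : Continuous fun z : StateSpace n × StateSpace n =>
        ‖form (act v.1 z.1) (act v.1 z.2)‖ :=
      ((form_continuous n).comp (((act_continuous v.1).comp continuous_fst).prodMk
        ((act_continuous v.1).comp continuous_snd))).norm
    have : capacityValues v = (fun z : StateSpace n × StateSpace n =>
        ‖form (act v.1 z.1) (act v.1 z.2)‖) '' T := by
      ext r
      constructor
      · rintro ⟨φ, ψ, h1, h2, h3, rfl⟩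
        exact ⟨(φ, ψ), ⟨⟨by simpa using h1, by simpa using h2⟩, h3⟩, rfl⟩
      · rintro ⟨⟨φ, ψ⟩, ⟨⟨h1, h2⟩, h3⟩, rfl⟩
        exact ⟨φ, ψ, by simpa using h1, by simpa using h2, h3, rfl⟩
    rw [this]
    exact hT.image hf
  have hne : (capacityValues v).Nonempty := by
    let j : Fin (2 ^ n) := ⟨0, by positivity⟩
    refine ⟨_, EuclideanSpace.single j 1, EuclideanSpace.single j 1, by simp, by simp, ?_, rfl⟩
    have hz : flipMatrix n j j = 0 := by
      refine Finset.prod_eq_zero (Finset.mem_univ (⟨0, hn⟩ : Fin n)) ?_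
      generalize bit j ⟨0, hn⟩ = b
      fin_cases b <;> simp [sigmaY]
    have hc : (fun k : Fin (2 ^ n) => starRingEnd ℂ ((EuclideanSpace.single j (1 : ℂ)) k)) =
        Pi.single j 1 := by
      funext k
      by_cases h : k = j <;> simp [h]
    have hact : spinFlip (EuclideanSpace.single j (1 : ℂ)) j = 0 := by
      simp only [spinFlip, act, hc, Matrix.mulVec_single_one]
      exact hz
    rw [form, EuclideanSpace.inner_single_left, hact]
    simp
  exact hcomp.isGreatest_sSup hne

end

end Concurrence

/-!
The spin-flip matrix has in row `j` a single nonzero entry, a sign `s_j` in column `N - 1 - j`, so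
the concurrence form is `∑ s_j φ_j ψ_{N-1-j}` (`form_eq_sum`). An element `a` of the torus is
diagonal with equal entries at `j` and `N - 1 - j`, and it multiplies the `j`-th summand by `a_j²`.
By Cauchy–Schwarz the capacity is at most one (`kappa_le_one`), and it equals one as soon as the
origin lies in the convex hull of the numbers `a_j²`: weights `p_j` with `∑ p_j a_j² = 0` give the
pair `φ_j = √p_j`, `ψ_{N-1-j} = s_j (conj a_j)² √p_j`, on which the form vanishes before the action
of `a` and equals `∑ p_j = 1` after it (`kappa_eq_one_of_weights`). The origin is in the convex hull
whenever the `a_j²` meet all four open quadrants (`exists_weights_of_quadrants`).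

The diagonal entries with even index `2 i`, `i < K`, where `2 K ≤ 2 ^ (n - 1)`, form a continuous
surjective homomorphism from `A` onto the `K`-th power of the circle (`evenEntries_surjective`), so
under Haar measure they are independent and uniform (`measurePreserving_evenEntries`). The square of
a uniform point lies in a given open quadrant with a positive probability that does not depend on
`n`, since that is a nonempty open condition. Hence the probability that one of the four quadrants
is missed is a sum of four terms decaying geometrically in `K` (`da_kappa_ne_one_le`), and `K` can
be taken to grow with `n`; here `K = p - 1` suffices for `n = 2 p - 1`.

Measurability holds because the elements of capacity one form a closed set
(`isClosed_kappa_eq_one`).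
-/

namespace Concurrence

/-! ### The concurrence form in coordinates -/

theorem bit_rev {n : ℕ} (j : Fin (2 ^ n)) (l : Fin n) : bit j.rev l = (bit j l).rev := by
  suffices h : finFunctionFinEquiv.symm j.rev = fun l => (bit j l).rev from congrFun h l
  rw [Equiv.symm_apply_eq]
  obtain ⟨f, rfl⟩ := finFunctionFinEquiv.surjective j
  have hsum : ∑ i : Fin n, 2 ^ (i : ℕ) = 2 ^ n - 1 := by
    rw [Fin.sum_univ_eq_sum_range (fun i => 2 ^ i) n, Nat.geomSum_eq le_rfl]
    simp
  have hadd : ∑ i : Fin n, ((f i).rev : ℕ) * 2 ^ (i : ℕ) +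
      ∑ i : Fin n, (f i : ℕ) * 2 ^ (i : ℕ) = 2 ^ n - 1 := by
    rw [← hsum, ← Finset.sum_add_distrib]
    refine Finset.sum_congr rfl fun i _ => ?_
    rw [← add_mul, Fin.val_rev, show 2 - ((f i : ℕ) + 1) + (f i : ℕ) = 1 by omega, one_mul]
  refine Fin.ext ?_
  rw [Fin.val_rev, finFunctionFinEquiv_apply, finFunctionFinEquiv_apply]
  simp only [bit, Equiv.symm_apply_apply]
  omega

/-- The only nonzero entry of `(-i σ^y)^{⊗ n}` in row `j` sits in the column `N - 1 - j`, whose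
index has the complementary binary digits. -/
theorem flipMatrix_eq_zero {n : ℕ} {j k : Fin (2 ^ n)} (h : k ≠ j.rev) : flipMatrix n j k = 0 := by
  have : ∃ l, bit k l ≠ bit j.rev l := by
    by_contra! hk
    exact h (finFunctionFinEquiv.symm.injective (funext hk))
  obtain ⟨l, hl⟩ := this
  refine Finset.prod_eq_zero (Finset.mem_univ l) ?_
  rw [bit_rev] at hl
  revert hl
  generalize bit j l = b
  generalize bit k l = c
  fin_cases b <;> fin_cases c <;> simp [sigmaY]

/-- The sign `±1` in row `j` of the spin-flip matrix. -/
noncomputable def flipSign {n : ℕ} (j : Fin (2 ^ n)) : ℂ := flipMatrix n j j.rev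

theorem flipSign_mul_self {n : ℕ} (j : Fin (2 ^ n)) : flipSign j * flipSign j = 1 := by
  rw [flipSign, flipMatrix, Matrix.of_apply, ← Finset.prod_mul_distrib]
  refine Finset.prod_eq_one fun l _ => ?_
  rw [bit_rev]
  generalize bit j l = b
  fin_cases b <;> simp [sigmaY]

theorem norm_flipSign {n : ℕ} (j : Fin (2 ^ n)) : ‖flipSign j‖ = 1 := by
  have h := congrArg norm (flipSign_mul_self j)
  rw [norm_mul, norm_one] at h
  nlinarith [norm_nonneg (flipSign j)]

theorem conj_flipSign {n : ℕ} (j : Fin (2 ^ n)) :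
    starRingEnd ℂ (flipSign j) = flipSign j := by
  rw [flipSign, flipMatrix, Matrix.of_apply, map_prod]
  refine Finset.prod_congr rfl fun l _ => ?_
  rw [bit_rev]
  generalize bit j l = b
  fin_cases b <;> simp [sigmaY]

theorem form_eq_sum {n : ℕ} (φ ψ : StateSpace n) :
    form φ ψ = ∑ j, flipSign j * φ j * ψ j.rev := by
  have hflip : ∀ j, spinFlip ψ j = flipSign j * starRingEnd ℂ (ψ j.rev) := by
    intro j
    simp only [spinFlip, act, Matrix.mulVec, dotProduct]
    exact Finset.sum_eq_single j.rev (fun k _ hk => by rw [flipMatrix_eq_zero hk, zero_mul])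
      (fun h => absurd (Finset.mem_univ _) h)
  rw [form, PiLp.inner_apply, map_sum]
  refine Finset.sum_congr rfl fun j _ => ?_
  rw [hflip]
  simp only [RCLike.inner_apply, map_mul, Complex.conj_conj, conj_flipSign]
  ring

/-- The Cauchy–Schwarz bound, the spin-flip being an isometry. -/
theorem norm_form_le {n : ℕ} (φ ψ : StateSpace n) : ‖form φ ψ‖ ≤ ‖φ‖ * ‖ψ‖ := by
  have hrev : ∑ j : Fin (2 ^ n), ‖ψ j.rev‖ ^ 2 = ‖ψ‖ ^ 2 := by
    rw [EuclideanSpace.norm_sq_eq]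
    exact Equiv.sum_comp Fin.revPerm fun j => ‖ψ j‖ ^ 2
  have hle : ‖form φ ψ‖ ≤ ∑ j, ‖φ j‖ * ‖ψ j.rev‖ := by
    rw [form_eq_sum]
    refine (norm_sum_le _ _).trans_eq (Finset.sum_congr rfl fun j _ => ?_)
    rw [norm_mul, norm_mul, norm_flipSign, one_mul]
  refine hle.trans (abs_le_of_sq_le_sq' ?_ (by positivity)).2
  rw [mul_pow, ← hrev, EuclideanSpace.norm_sq_eq]
  exact Finset.sum_mul_sq_le_sq_mul_sq _ _ _

/-! ### Elements of the torus -/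

/-- The `l`-th diagonal entry of an element of the torus `A`. -/
noncomputable def entry {n : ℕ} (a : oddTorus n) (l : Fin (2 ^ n)) : ℂ := a.1.1 l l

theorem phase_rev {n : ℕ} (t : GenIdx n → ℝ) (l : Fin (2 ^ n)) : phase t l.rev = phase t l := by
  unfold phase
  refine Finset.sum_congr rfl fun q _ => ?_
  have h : genPhase q.1.1 q.1.2 l.rev = genPhase q.1.1 q.1.2 l := by
    simp only [genPhase, Pi.add_apply, Pi.sub_apply, Pi.single_apply, Fin.rev_inj]
    simp only [Fin.rev_eq_iff]
    ring
  rw [h]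

theorem exists_param {n : ℕ} (a : oddTorus n) : ∃ t : GenIdx n → ℝ, param t = a := by
  have h : a ∈ param (n := n) '' (Set.Icc 0 fun _ => 2 * Real.pi) := by
    rw [param_surjOn]
    trivial
  exact ⟨h.choose, h.choose_spec.2⟩

theorem entry_param {n : ℕ} (t : GenIdx n → ℝ) (l : Fin (2 ^ n)) :
    entry (param t) l = Circle.exp (phase t l) := by
  rw [Circle.coe_exp]
  exact Matrix.diagonal_apply_eq _ _

theorem norm_entry {n : ℕ} (a : oddTorus n) (l : Fin (2 ^ n)) : ‖entry a l‖ = 1 := by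
  obtain ⟨t, rfl⟩ := exists_param a
  rw [entry_param, Circle.norm_coe]

theorem entry_rev {n : ℕ} (a : oddTorus n) (l : Fin (2 ^ n)) : entry a l.rev = entry a l := by
  obtain ⟨t, rfl⟩ := exists_param a
  rw [entry_param, entry_param, phase_rev]

theorem coe_eq_diagonal {n : ℕ} (a : oddTorus n) : a.1.1 = Matrix.diagonal (entry a) := by
  obtain ⟨t, rfl⟩ := exists_param a
  change Matrix.diagonal _ = _
  congr 1
  funext l
  rw [entry_param, Circle.coe_exp]

theorem entry_mul {n : ℕ} (a b : oddTorus n) (l : Fin (2 ^ n)) :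
    entry (a * b) l = entry a l * entry b l := by
  change (a.1.1 * b.1.1) l l = _
  rw [coe_eq_diagonal, coe_eq_diagonal, Matrix.diagonal_mul_diagonal, Matrix.diagonal_apply_eq]

theorem act_apply {n : ℕ} (a : oddTorus n) (φ : StateSpace n) (l : Fin (2 ^ n)) :
    act a.1.1 φ l = entry a l * φ l := by
  rw [act, coe_eq_diagonal]
  exact Matrix.mulVec_diagonal (entry a) φ.ofLp l

theorem norm_act {n : ℕ} (a : oddTorus n) (φ : StateSpace n) : ‖act a.1.1 φ‖ = ‖φ‖ := by
  simp only [EuclideanSpace.norm_eq, act_apply, norm_mul, norm_entry, one_mul]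

theorem form_act {n : ℕ} (a : oddTorus n) (φ ψ : StateSpace n) :
    form (act a.1.1 φ) (act a.1.1 ψ) = ∑ j, entry a j ^ 2 * (flipSign j * φ j * ψ j.rev) := by
  rw [form_eq_sum]
  refine Finset.sum_congr rfl fun j _ => ?_
  rw [act_apply, act_apply, entry_rev]
  ring

/-! ### Capacity one -/

theorem kappa_le_one {n : ℕ} (hn : 1 ≤ n) (a : oddTorus n) : kappa a.1 ≤ 1 := by
  obtain ⟨φ, ψ, hφ, hψ, -, h⟩ := (isGreatest_kappa hn a.1).1
  rw [h]
  refine (norm_form_le _ _).trans_eq ?_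
  rw [norm_act, norm_act, hφ, hψ, one_mul]

theorem kappa_eq_one_iff {n : ℕ} (hn : 1 ≤ n) (a : oddTorus n) :
    kappa a.1 = 1 ↔ (1 : ℝ) ∈ capacityValues a.1 :=
  ⟨fun h => h ▸ (isGreatest_kappa hn a.1).1,
    fun h => (kappa_le_one hn a).antisymm ((isGreatest_kappa hn a.1).2 h)⟩

/-- The elements of capacity one are the projection of a closed set along a compact factor (the
pairs of normalized states). -/
theorem isClosed_kappa_eq_one {n : ℕ} (hn : 1 ≤ n) :
    IsClosed {a : oddTorus n | kappa a.1 = 1} := by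
  let S : Set (oddTorus n × StateSpace n × StateSpace n) :=
    {z | ‖z.2.1‖ = 1 ∧ ‖z.2.2‖ = 1 ∧ form z.2.1 z.2.2 = 0 ∧
      1 = ‖form (act z.1.1.1 z.2.1) (act z.1.1.1 z.2.2)‖}
  have hact : ∀ f : oddTorus n × StateSpace n × StateSpace n → StateSpace n, Continuous f →
      Continuous fun z => act z.1.1.1 (f z) := by
    intro f hf
    unfold act
    refine (PiLp.continuous_toLp 2 _).comp (Continuous.matrix_mulVec ?_ ?_)
    · exact continuous_subtype_val.comp (continuous_subtype_val.comp continuous_fst)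
    · exact (PiLp.continuous_ofLp 2 _).comp hf
  have h1 : Continuous fun z : oddTorus n × StateSpace n × StateSpace n => z.2.1 := by fun_prop
  have h2 : Continuous fun z : oddTorus n × StateSpace n × StateSpace n => z.2.2 := by fun_prop
  have hS : IsClosed S :=
    (isClosed_eq h1.norm continuous_const).inter <|
      (isClosed_eq h2.norm continuous_const).inter <|
      (isClosed_eq ((form_continuous n).comp (h1.prodMk h2)) continuous_const).inter <|
      isClosed_eq continuous_const
        ((form_continuous n).comp ((hact _ h1).prodMk (hact _ h2))).norm
  have hScomp : IsCompact S := by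
    refine (isCompact_univ.prod ((isCompact_sphere (0 : StateSpace n) 1).prod
      (isCompact_sphere (0 : StateSpace n) 1))).of_isClosed_subset hS fun z hz => ?_
    exact ⟨trivial, by simpa using hz.1, by simpa using hz.2.1⟩
  convert (hScomp.image continuous_fst).isClosed using 1
  ext a
  rw [Set.mem_ofPred_eq, kappa_eq_one_iff hn]
  constructor
  · rintro ⟨φ, ψ, h⟩
    exact ⟨(a, φ, ψ), h, rfl⟩
  · rintro ⟨⟨b, φ, ψ⟩, h, rfl⟩
    exact ⟨φ, ψ, h⟩

/-- If the origin is a convex combination (with unnormalized weights `w`) of the squared diagonal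
entries of `a`, then `a` has capacity one. -/
theorem kappa_eq_one_of_weights {n : ℕ} (hn : 1 ≤ n) (a : oddTorus n) (w : Fin (2 ^ n) → ℝ)
    (hw : ∀ j, 0 ≤ w j) (hpos : 0 < ∑ j, w j) (hzero : ∑ j, (w j : ℂ) * entry a j ^ 2 = 0) :
    kappa a.1 = 1 := by
  set W := ∑ j, w j with hW
  let c : Fin (2 ^ n) → ℝ := fun j => √(w j / W)
  have hcc : ∀ j, (c j : ℂ) * c j = w j / W := by
    intro j
    rw [← Complex.ofReal_mul, Real.mul_self_sqrt (div_nonneg (hw j) hpos.le), Complex.ofReal_div]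
  have hcsum : ∑ j, c j ^ 2 = 1 := by
    have : ∀ j, c j ^ 2 = w j / W := fun j => Real.sq_sqrt (div_nonneg (hw j) hpos.le)
    rw [Finset.sum_congr rfl fun j _ => this j, ← Finset.sum_div, ← hW, div_self hpos.ne']
  have hcnorm : ∀ j, ‖(c j : ℂ)‖ = c j := fun j => by
    rw [Complex.norm_real, Real.norm_of_nonneg (Real.sqrt_nonneg _)]
  -- The phases of `ψ` make every summand of the form on `(a φ, a ψ)` real and nonnegative.
  let φ : StateSpace n := WithLp.toLp 2 fun j => (c j : ℂ)
  let ψ : StateSpace n := WithLp.toLp 2 fun j =>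
    flipSign j.rev * starRingEnd ℂ (entry a j.rev ^ 2) * c j.rev
  have hterm : ∀ j, flipSign j * φ j * ψ j.rev = starRingEnd ℂ ((w j : ℂ) * entry a j ^ 2) / W := by
    intro j
    simp only [φ, ψ, Fin.rev_rev]
    rw [map_mul, Complex.conj_ofReal]
    linear_combination (c j * starRingEnd ℂ (entry a j ^ 2) * c j : ℂ) * flipSign_mul_self j +
      starRingEnd ℂ (entry a j ^ 2) * hcc j
  rw [kappa_eq_one_iff hn]
  refine ⟨φ, ψ, ?_, ?_, ?_, ?_⟩
  · rw [EuclideanSpace.norm_eq, Real.sqrt_eq_one, ← hcsum]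
    exact Finset.sum_congr rfl fun j _ => by rw [← hcnorm]
  · rw [EuclideanSpace.norm_eq, Real.sqrt_eq_one, ← hcsum,
      ← Equiv.sum_comp Fin.revPerm fun j => c j ^ 2]
    refine Finset.sum_congr rfl fun j _ => ?_
    simp only [ψ, norm_mul, norm_flipSign, RCLike.norm_conj, norm_pow, norm_entry, one_pow, one_mul,
      hcnorm, Fin.revPerm_apply]
  · rw [form_eq_sum, Finset.sum_congr rfl fun j _ => hterm j, ← Finset.sum_div, ← map_sum, hzero]
    simp
  · have h1 : ∀ j, entry a j ^ 2 * (flipSign j * φ j * ψ j.rev) = ((w j / W : ℝ) : ℂ) := by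
      intro j
      have hu : entry a j * starRingEnd ℂ (entry a j) = 1 := by
        rw [Complex.mul_conj, Complex.normSq_eq_norm_sq, norm_entry]
        simp
      rw [hterm, map_mul, Complex.conj_ofReal, map_pow]
      push_cast
      linear_combination (w j / W : ℂ) * (entry a j * starRingEnd ℂ (entry a j) + 1) * hu
    rw [form_act, Finset.sum_congr rfl fun j _ => h1 j, ← Complex.ofReal_sum, ← Finset.sum_div,
      ← hW, div_self hpos.ne']
    simp

/-- One point in each of the four open quadrants of the plane. -/
noncomputable abbrev quadrantSigns : Finset ℂ := {⟨1, 1⟩, ⟨-1, 1⟩, ⟨-1, -1⟩, ⟨1, -1⟩}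

/-- Points of the plane that meet all four open quadrants have the origin in their convex hull. -/
theorem exists_weights_of_quadrants {ι : Type*} [Fintype ι] (z : ι → ℂ)
    (h : ∀ σ ∈ quadrantSigns,
      ∃ j, 0 < σ.re * (z j).re ∧ 0 < σ.im * (z j).im) :
    ∃ w : ι → ℝ, (∀ j, 0 ≤ w j) ∧ 0 < ∑ j, w j ∧ ∑ j, (w j : ℂ) * z j = 0 := by
  classical
  obtain ⟨j₁, x₁, y₁⟩ := h ⟨1, 1⟩ (by simp)
  obtain ⟨j₂, x₂, y₂⟩ := h ⟨-1, 1⟩ (by simp)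
  obtain ⟨j₃, x₃, y₃⟩ := h ⟨-1, -1⟩ (by simp)
  obtain ⟨j₄, x₄, y₄⟩ := h ⟨1, -1⟩ (by simp)
  simp only [one_mul, neg_mul] at x₁ y₁ x₂ y₂ x₃ y₃ x₄ y₄
  -- `p` is the height at which the segment from `z j₁` to `z j₂` meets the imaginary axis, up to
  -- a positive factor; `q` is the depth at which the one from `z j₃` to `z j₄` does.
  set p := -(z j₂).re * (z j₁).im + (z j₁).re * (z j₂).im with hp
  set q := (z j₄).re * -(z j₃).im + -(z j₃).re * -(z j₄).im with hq
  have hp0 : 0 < p := by positivity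
  have hq0 : 0 < q := by positivity
  have m₁ : 0 < q * -(z j₂).re := by positivity
  have m₂ : 0 < q * (z j₁).re := by positivity
  have m₃ : 0 < p * (z j₄).re := by positivity
  have m₄ : 0 < p * -(z j₃).re := by positivity
  refine ⟨Pi.single j₁ (q * -(z j₂).re) + Pi.single j₂ (q * (z j₁).re) +
    Pi.single j₃ (p * (z j₄).re) + Pi.single j₄ (p * -(z j₃).re), fun j => ?_, ?_, ?_⟩
  · simp only [Pi.add_apply]
    have hs : ∀ (i : ι) (x : ℝ), 0 < x → 0 ≤ (Pi.single i x : ι → ℝ) j := fun i x hx => by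
      rw [Pi.single_apply]
      split_ifs <;> simp [hx.le]
    have := hs j₁ _ m₁
    have := hs j₂ _ m₂
    have := hs j₃ _ m₃
    have := hs j₄ _ m₄
    positivity
  · simp only [Pi.add_apply, Finset.sum_add_distrib, Finset.sum_pi_single', Finset.mem_univ,
      if_true]
    positivity
  · have hs : ∀ (i : ι) (x : ℝ), ∑ j, (((Pi.single i x : ι → ℝ) j : ℝ) : ℂ) * z j = x * z i := by
      intro i x
      rw [Finset.sum_eq_single i (fun j _ hj => by rw [Pi.single_eq_of_ne hj]; simp)
        (fun h => absurd (Finset.mem_univ _) h), Pi.single_eq_same]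
    simp only [Pi.add_apply, Complex.ofReal_add, add_mul, Finset.sum_add_distrib, hs]
    apply Complex.ext
    · simp only [Complex.add_re, Complex.re_ofReal_mul, Complex.zero_re]
      ring
    · simp only [Complex.add_im, Complex.im_ofReal_mul, Complex.zero_im, hp, hq]
      ring

/-! ### Independent coordinates of the torus -/

noncomputable instance instMeasurableSpaceCircle : MeasurableSpace Circle := borel _

instance instBorelSpaceCircle : BorelSpace Circle := ⟨rfl⟩

/-- The Haar probability measure on the circle. -/
noncomputable def circleHaar : Measure Circle :=
  Measure.haarMeasure (⊤ : TopologicalSpace.PositiveCompacts Circle)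

instance instHaarCircleHaar : circleHaar.IsHaarMeasure :=
  Measure.isHaarMeasure_haarMeasure _

instance instProbabilityCircleHaar : IsProbabilityMeasure circleHaar :=
  ⟨Measure.haarMeasure_self (K₀ := (⊤ : TopologicalSpace.PositiveCompacts Circle))⟩

instance instHaarDa (n : ℕ) : (da n).IsHaarMeasure :=
  Measure.isHaarMeasure_haarMeasure _

theorem evenIndex_lt {n K : ℕ} (hK : 2 * K ≤ 2 ^ (n - 1)) (i : Fin K) :
    2 * (i : ℕ) + 1 < 2 ^ (n - 1) ∧ 2 ^ (n - 1) + 2 ^ (n - 1) = 2 ^ n := by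
  have hi := i.2
  refine ⟨by omega, ?_⟩
  rcases n with _ | n
  · rw [zero_tsub, pow_zero] at hK
    omega
  · rw [Nat.add_sub_cancel, pow_succ]
    ring

/-- The basis index `2 i`, for `2 i` in the first half of the basis. -/
def evenIndex {n K : ℕ} (hK : 2 * K ≤ 2 ^ (n - 1)) (i : Fin K) : Fin (2 ^ n) :=
  ⟨2 * i, by have := evenIndex_lt hK i; omega⟩

/-- The homomorphism from `A` to a power of the circle that records the diagonal entries with even
index in the first half of the basis. -/
noncomputable def evenEntries {n K : ℕ} (hK : 2 * K ≤ 2 ^ (n - 1)) :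
    oddTorus n →* (Fin K → Circle) :=
  MonoidHom.mk' (fun a i => ⟨entry a (evenIndex hK i), mem_sphere_zero_iff_norm.2 (norm_entry _ _)⟩)
    fun a b => funext fun _ => Circle.ext (entry_mul a b _)

theorem coe_evenEntries {n K : ℕ} (hK : 2 * K ≤ 2 ^ (n - 1)) (a : oddTorus n) (i : Fin K) :
    (evenEntries hK a i : ℂ) = entry a (evenIndex hK i) := rfl

theorem continuous_evenEntries {n K : ℕ} (hK : 2 * K ≤ 2 ^ (n - 1)) :
    Continuous (evenEntries hK) := by
  refine continuous_pi fun i => Continuous.subtype_mk ?_ _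
  exact (continuous_subtype_val.comp continuous_subtype_val).matrix_elem _ _

/-- The generator with `j = 2 i` is the only generator with even `j` that has a nonzero phase at
`2 i`; using only these generators, the phases at the even indices are therefore arbitrary. -/
theorem evenEntries_surjective {n K : ℕ} (hK : 2 * K ≤ 2 ^ (n - 1)) :
    Function.Surjective (evenEntries hK) := by
  intro u
  choose θ hθ using fun i : Fin K => Circle.exp_surjective (u i)
  let t : GenIdx n → ℝ := fun q =>
    if h : (q.1.1 : ℕ) % 2 = 0 ∧ (q.1.1 : ℕ) / 2 < K then θ ⟨_, h.2⟩ else 0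
  refine ⟨param t, funext fun i => Circle.ext ?_⟩
  rw [coe_evenEntries, entry_param, ← hθ]
  congr 2
  obtain ⟨hi, hN⟩ := evenIndex_lt hK i
  let q₀ : GenIdx n := ⟨(evenIndex hK i, ⟨2 * i + 1, by omega⟩), rfl, by
    change 2 * (i : ℕ) + 2 ≤ _
    omega⟩
  rw [phase, Finset.sum_eq_single q₀ ?_ (fun h => absurd (Finset.mem_univ _) h)]
  · have ht : t q₀ = θ i := by
      have h : ((q₀.1.1 : ℕ) % 2 = 0 ∧ (q₀.1.1 : ℕ) / 2 < K) := by
        change (2 * (i : ℕ)) % 2 = 0 ∧ (2 * (i : ℕ)) / 2 < K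
        have := i.2
        omega
      simp only [t, dif_pos h]
      congr 1
      refine Fin.ext ?_
      change (2 * (i : ℕ)) / 2 = i
      omega
    have hg : genPhase q₀.1.1 q₀.1.2 (evenIndex hK i) = 1 := by
      simp only [genPhase, Pi.add_apply, Pi.sub_apply, Pi.single_apply, Fin.ext_iff, Fin.val_rev,
        q₀, evenIndex]
      rw [if_pos trivial, if_neg (by omega), if_neg (by omega), if_neg (by omega)]
      rfl
    rw [ht, hg, Int.cast_one, mul_one]
  · rintro ⟨⟨j, k⟩, hk, hj⟩ - hne
    by_cases hpar : (j : ℕ) % 2 = 0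
    · have hji : (j : ℕ) ≠ 2 * i := by
        intro h
        refine hne (Subtype.ext (Prod.ext (Fin.ext h) (Fin.ext ?_)))
        change (k : ℕ) = 2 * i + 1
        simp only at hk
        omega
      have hg : genPhase j k (evenIndex hK i) = 0 := by
        simp only at hk hj
        simp only [genPhase, Pi.add_apply, Pi.sub_apply, Pi.single_apply, Fin.ext_iff, Fin.val_rev,
          evenIndex]
        rw [if_neg (by omega), if_neg (by omega), if_neg (by omega), if_neg (by omega)]
        rfl
      simp only [hg, Int.cast_zero, mul_zero]
    · simp only [t, dif_neg (fun h : (j : ℕ) % 2 = 0 ∧ (j : ℕ) / 2 < K => hpar h.1), zero_mul]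

theorem measurePreserving_evenEntries {n K : ℕ} (hK : 2 * K ≤ 2 ^ (n - 1)) :
    MeasurePreserving (evenEntries hK) (da n) (Measure.pi fun _ => circleHaar) :=
  (evenEntries hK).measurePreserving (continuous_evenEntries hK) (evenEntries_surjective hK)
    (by rw [measure_univ, measure_univ])

/-! ### The probability of capacity one -/

/-- The points of the circle whose square lies in the open quadrant of `σ` (for `σ` on neither
axis). -/
def quadrantRoots (σ : ℂ) : Set Circle :=
  {u | 0 < σ.re * ((u : ℂ) ^ 2).re ∧ 0 < σ.im * ((u : ℂ) ^ 2).im}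

theorem isOpen_quadrantRoots (σ : ℂ) : IsOpen (quadrantRoots σ) := by
  have h : Continuous fun u : Circle => (u : ℂ) ^ 2 := continuous_subtype_val.pow 2
  exact (isOpen_lt continuous_const (continuous_const.mul (Complex.continuous_re.comp h))).inter
    (isOpen_lt continuous_const (continuous_const.mul (Complex.continuous_im.comp h)))

theorem quadrantRoots_nonempty {σ : ℂ} (hre : σ.re ≠ 0) (him : σ.im ≠ 0) :
    (quadrantRoots σ).Nonempty := by
  have hσ : σ ≠ 0 := fun h => hre (by rw [h, Complex.zero_re])
  have hn : 0 < ‖σ‖ := norm_pos_iff.2 hσ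
  have hsq : ((Circle.exp (σ.arg / 2) : Circle) : ℂ) ^ 2 = Complex.exp (σ.arg * Complex.I) := by
    rw [Circle.coe_exp, ← Complex.exp_nat_mul]
    congr 1
    push_cast
    ring
  refine ⟨Circle.exp (σ.arg / 2), ?_, ?_⟩
  · rw [hsq, Complex.exp_ofReal_mul_I_re, Complex.cos_arg hσ, mul_div_assoc']
    have := mul_self_pos.2 hre
    positivity
  · rw [hsq, Complex.exp_ofReal_mul_I_im, Complex.sin_arg, mul_div_assoc']
    have := mul_self_pos.2 him
    positivity

theorem circleHaar_compl_quadrantRoots_lt_one {σ : ℂ} (hre : σ.re ≠ 0) (him : σ.im ≠ 0) :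
    circleHaar (quadrantRoots σ)ᶜ < 1 := by
  rw [prob_compl_eq_one_sub (isOpen_quadrantRoots σ).measurableSet]
  exact ENNReal.sub_lt_self ENNReal.one_ne_top one_ne_zero
    ((isOpen_quadrantRoots σ).measure_pos _ (quadrantRoots_nonempty hre him)).ne'

/-- Failure of capacity one forces the `K` independent uniform entries to have squares that all
avoid one of the four quadrants. -/
theorem da_kappa_ne_one_le {n K : ℕ} (hn : 1 ≤ n) (hK : 2 * K ≤ 2 ^ (n - 1)) :
    da n {a : oddTorus n | kappa a.1 = 1}ᶜ ≤
      ∑ σ ∈ quadrantSigns, circleHaar (quadrantRoots σ)ᶜ ^ K := by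
  have hsub : {a : oddTorus n | kappa a.1 = 1}ᶜ ⊆
      ⋃ σ ∈ quadrantSigns,
        evenEntries hK ⁻¹' Set.univ.pi fun _ => (quadrantRoots σ)ᶜ := by
    intro a ha
    by_contra hcon
    simp only [Set.mem_iUnion, not_exists] at hcon
    refine ha ?_
    obtain ⟨w, hw, hpos, hzero⟩ := exists_weights_of_quadrants (fun j => entry a j ^ 2)
      fun σ hσ => by
        have hσa := hcon σ hσ
        simp only [Set.mem_preimage, Set.mem_univ_pi, not_forall, Set.mem_compl_iff,
          not_not] at hσa
        obtain ⟨i, hi⟩ := hσa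
        exact ⟨evenIndex hK i, hi⟩
    exact kappa_eq_one_of_weights hn a w hw hpos hzero
  refine (measure_mono hsub).trans ((measure_biUnion_finset_le _ _).trans_eq ?_)
  refine Finset.sum_congr rfl fun σ _ => ?_
  rw [(measurePreserving_evenEntries hK).measure_preimage
    (MeasurableSet.univ_pi fun _ =>
      (isOpen_quadrantRoots σ).measurableSet.compl).nullMeasurableSet, Measure.pi_pi]
  simp

theorem tendsto_da_kappa_eq_one :
    Tendsto (fun p : ℕ => da (2 * p - 1) {a : oddTorus (2 * p - 1) | kappa a.1 = 1})
      atTop (𝓝 1) := by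
  set b : ℕ → ENNReal := fun K => ∑ σ ∈ quadrantSigns, circleHaar (quadrantRoots σ)ᶜ ^ K
  have hb : Tendsto b atTop (𝓝 0) := by
    rw [← Finset.sum_const_zero (s := quadrantSigns)]
    refine tendsto_finsetSum _ fun σ hσ => ENNReal.tendsto_pow_atTop_nhds_zero_of_lt_one ?_
    simp only [Finset.mem_insert, Finset.mem_singleton] at hσ
    rcases hσ with rfl | rfl | rfl | rfl <;>
      exact circleHaar_compl_quadrantRoots_lt_one (by norm_num) (by norm_num)
  have hlim : Tendsto (fun p : ℕ => 1 - b (p - 1)) atTop (𝓝 1) := by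
    have := ENNReal.Tendsto.sub (tendsto_const_nhds (x := (1 : ENNReal)))
      (hb.comp (tendsto_sub_atTop_nat 1)) (Or.inl ENNReal.one_ne_top)
    simpa using this
  refine tendsto_of_tendsto_of_tendsto_of_le_of_le' hlim tendsto_const_nhds ?_
    (Eventually.of_forall fun p => prob_le_one)
  filter_upwards [eventually_ge_atTop 1] with p hp
  have hn : 1 ≤ 2 * p - 1 := by omega
  have hK : 2 * (p - 1) ≤ 2 ^ (2 * p - 1 - 1) := by
    rw [show 2 * p - 1 - 1 = 2 * (p - 1) by omega]
    exact Nat.lt_two_pow_self.le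
  have h := da_kappa_ne_one_le hn hK
  rw [prob_compl_eq_one_sub (isClosed_kappa_eq_one hn).measurableSet] at h
  exact tsub_le_iff_tsub_le.1 h

end Concurrence

theorem mainTheorem5 :
    (∀ p : ℕ, 1 ≤ p →
      MeasurableSet {a : Concurrence.oddTorus (2 * p - 1) | Concurrence.kappa a.1 = 1}) ∧
    Tendsto
      (fun p : ℕ => Concurrence.da (2 * p - 1)
        {a : Concurrence.oddTorus (2 * p - 1) | Concurrence.kappa a.1 = 1})
      atTop (𝓝 1) :=
  ⟨fun _ hp => (Concurrence.isClosed_kappa_eq_one (by omega)).measurableSet,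
    Concurrence.tendsto_da_kappa_eq_one⟩
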